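/- Let $n\ge 2$ be an integer, let $\alpha\in[0,1]$, and let $$\rho_n^{\alpha}=\frac{1-\alpha}{2^n}\,|0\rangle\langle 0|\otimes I_n+\frac{\alpha}{2^{n+1}}\,I_{n+1}$$ be the initial state of an $(n+1)$-qubit DQC1 circuit, where $|0\rangle\langle 0|$ acts on the first qubit and $I_k$ is the identity on $k$ qubits. A circuit implementing the unitary $U$ on $n+1$ qubits produces the state $U\rho_n^{\alpha}U^\dagger$. A $\{1;n\}$ bipartition splits the $n+1$ qubits into one (arbitrary) qubit and the $n$ remaining ones; there are $n+1$ of them. A state is separable across a bipartition $\{A;B\}$ if it is a finite convex combination of states $\rho^A\otimes\rho^B$, with $\rho^A$, $\rho^B$ density matrices on the two parties, and it is entangled across $\{A;B\}$ otherwise. Then there are no unitary $U$ and no $\{1;n\}$ bipartition such that $U\rho_n^{\alpha}U^\dagger$ is entangled across that bipartition if and only if $\alpha\ge\frac12$. Moreover, the same holds for each $\{1;n\}$ bipartition separately: no unitary $U$ makes $U\rho_n^{\alpha}U^\dagger$ entangled across it if and only if $\alpha\ge\frac12$. -/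

import Mathlib

open scoped Kronecker Matrix ComplexOrder

/-- The index set of the computational basis of `m` qubits. -/
abbrev Bits (m : ℕ) : Type := Fin m → Fin 2

/-- A state (density matrix): a positive semidefinite matrix with trace one. -/
def IsState {ι : Type} [Fintype ι] (ρ : Matrix ι ι ℂ) : Prop :=
  ρ.PosSemidef ∧ ρ.trace = 1

/-- A matrix on `H_A ⊗ H_B` is separable if it is a finite convex combination of
tensor products of states on `H_A` with states on `H_B`. -/
def IsSeparableState {A B : Type} [Fintype A] [Fintype B] (ρ : Matrix (A × B) (A × B) ℂ) : Prop :=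
  ∃ (m : ℕ) (p : Fin m → ℝ) (ρA : Fin m → Matrix A A ℂ) (ρB : Fin m → Matrix B B ℂ),
    (∀ l, 0 ≤ p l) ∧ ∑ l, p l = 1 ∧ (∀ l, IsState (ρA l)) ∧ (∀ l, IsState (ρB l)) ∧
      ρ = ∑ l, (p l : ℂ) • (ρA l ⊗ₖ ρB l)

/-- The identification of the basis of `n + 1` qubits with the product of the basis of qubit `j`
and the basis of the `n` other qubits (in their order). -/
def qubitSplit {n : ℕ} (j : Fin (n + 1)) : Bits (n + 1) ≃ Fin 2 × Bits n :=
  (Fin.insertNthEquiv (fun _ => Fin 2) j).symm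

/-- The `(n + 1)`-qubit state `ρ` is entangled across the `{1;n}` bipartition whose one-qubit party
is qubit `j`: seen on `ℂ² ⊗ (ℂ²)^{⊗ n}`, it is not separable. -/
def EntangledAcross {n : ℕ} (j : Fin (n + 1)) (ρ : Matrix (Bits (n + 1)) (Bits (n + 1)) ℂ) :
    Prop :=
  ¬ IsSeparableState (Matrix.reindex (qubitSplit j) (qubitSplit j) ρ)

/-- The input of an `(n + 1)`-qubit DQC1 circuit:
`(1 - α) / 2 ^ n • |0⟩⟨0| ⊗ 1_n + α / 2 ^ (n + 1) • 1_{n + 1}`, where `|0⟩⟨0|` acts on the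
first qubit (qubit `0`). -/
noncomputable def dqc1State (n : ℕ) (α : ℝ) : Matrix (Bits (n + 1)) (Bits (n + 1)) ℂ :=
  (((1 - α) / 2 ^ n : ℝ) : ℂ) •
      Matrix.reindex (qubitSplit (0 : Fin (n + 1))).symm (qubitSplit (0 : Fin (n + 1))).symm
        ((Matrix.single 0 0 1 : Matrix (Fin 2) (Fin 2) ℂ) ⊗ₖ (1 : Matrix (Bits n) (Bits n) ℂ)) +
    ((α / 2 ^ (n + 1) : ℝ) : ℂ) • (1 : Matrix (Bits (n + 1)) (Bits (n + 1)) ℂ)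

/-- The state `U ρ U†` that a DQC1 circuit implementing the unitary `U` produces. -/
noncomputable def dqc1Output (n : ℕ) (α : ℝ) (U : Matrix.unitaryGroup (Bits (n + 1)) ℂ) :
    Matrix (Bits (n + 1)) (Bits (n + 1)) ℂ :=
  (U : Matrix (Bits (n + 1)) (Bits (n + 1)) ℂ) * dqc1State n α *
    (U : Matrix (Bits (n + 1)) (Bits (n + 1)) ℂ)ᴴ

/-- A finite sum of tensor products of positive semidefinite matrices with trace one is
separable. -/
theorem isSeparableState_of_sum_kronecker {A B ι : Type} [Fintype A] [Fintype B] [Fintype ι]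
    [DecidableEq A] [DecidableEq B] [Nonempty A] [Nonempty B]
    (X : ι → Matrix A A ℂ) (Y : ι → Matrix B B ℂ) (hX : ∀ i, (X i).PosSemidef)
    (hY : ∀ i, (Y i).PosSemidef) (htr : (∑ i, X i ⊗ₖ Y i).trace = 1) :
    IsSeparableState (∑ i, X i ⊗ₖ Y i) := by
  have normalize : ∀ {C : Type} [Fintype C] [DecidableEq C] [Nonempty C] (Z : Matrix C C ℂ),
      Z.PosSemidef → ∃ (t : ℝ) (σ : Matrix C C ℂ), 0 ≤ t ∧ IsState σ ∧ Z = (t : ℂ) • σ := by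
    intro C _ _ _ Z hZ
    by_cases h0 : Z.trace = 0
    · obtain ⟨c⟩ := ‹Nonempty C›
      refine ⟨0, Matrix.diagonal (Pi.single c 1), le_rfl, ⟨?_, ?_⟩, ?_⟩
      · refine Matrix.PosSemidef.diagonal fun i => ?_
        by_cases h : i = c
        · subst h; simp
        · simp [h]
      · simp
      · simpa using hZ.trace_eq_zero_iff.mp h0
    · have hnn := hZ.trace_nonneg
      have hre : ((Z.trace.re : ℝ) : ℂ) = Z.trace := by
        obtain ⟨-, h⟩ := Complex.nonneg_iff.mp hnn
        exact Complex.ext (by simp) (by simp [← h])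
      have hre0 : 0 ≤ Z.trace.re := (Complex.nonneg_iff.mp hnn).1
      refine ⟨Z.trace.re, ((Z.trace.re⁻¹ : ℝ) : ℂ) • Z, hre0, ⟨?_, ?_⟩, ?_⟩
      · exact hZ.smul (by exact_mod_cast inv_nonneg.mpr hre0)
      · rw [Matrix.trace_smul, Complex.ofReal_inv, hre, smul_eq_mul, inv_mul_cancel₀ h0]
      · rw [Complex.ofReal_inv, hre, smul_smul, mul_inv_cancel₀ h0, one_smul]
  choose s σ hs hσ hXσ using fun i => normalize (X i) (hX i)
  choose t τ ht hτ hYτ using fun i => normalize (Y i) (hY i)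
  have hterm : ∀ i, X i ⊗ₖ Y i = ((s i * t i : ℝ) : ℂ) • (σ i ⊗ₖ τ i) := by
    intro i
    rw [hXσ i, hYτ i, Matrix.smul_kronecker, Matrix.kronecker_smul, smul_smul, Complex.ofReal_mul]
  have hsum : ∑ i, s i * t i = 1 := by
    have h : ((∑ i, s i * t i : ℝ) : ℂ) = 1 := by
      rw [← htr, Matrix.trace_sum, Complex.ofReal_sum]
      refine Finset.sum_congr rfl fun i _ => ?_
      rw [hterm i, Matrix.trace_smul, Matrix.trace_kronecker, (hσ i).2, (hτ i).2]
      simp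
    exact_mod_cast h
  let e := Fintype.equivFin ι
  refine ⟨Fintype.card ι, fun l => s (e.symm l) * t (e.symm l), fun l => σ (e.symm l),
    fun l => τ (e.symm l), fun l => mul_nonneg (hs _) (ht _), ?_, fun l => hσ _, fun l => hτ _, ?_⟩
  · rw [← hsum]
    exact e.symm.sum_comp fun i => s i * t i
  · rw [e.symm.sum_comp fun i => ((s i * t i : ℝ) : ℂ) • (σ i ⊗ₖ τ i)]
    exact Finset.sum_congr rfl fun i _ => hterm i

open scoped Matrix.Norms.L2Operator in
/-- Spectral decomposition of a unitary matrix, with unimodular eigenvalues and positive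
semidefinite spectral projections. -/
theorem exists_spectral_decomposition_of_unitary {N : Type} [Fintype N] [DecidableEq N]
    (W : Matrix N N ℂ) (hW : W ∈ Matrix.unitaryGroup N ℂ) :
    ∃ (S : Finset ℂ) (Q : ℂ → Matrix N N ℂ), (∀ z ∈ S, ‖z‖ = 1) ∧ (∀ z, (Q z).PosSemidef) ∧
      ∑ z ∈ S, Q z = 1 ∧ ∑ z ∈ S, z • Q z = W := by
  have hfin : (spectrum ℂ W).Finite := Matrix.finite_spectrum W
  have hn : IsStarNormal W := ⟨by
    rw [commute_iff_eq, Unitary.star_mul_self_of_mem hW, Unitary.mul_star_self_of_mem hW]⟩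
  have hc : ∀ f : ℂ → ℂ, ContinuousOn f (spectrum ℂ W) := fun f => hfin.continuousOn f
  refine ⟨hfin.toFinset, fun z => cfc (fun x => if x = z then (1 : ℂ) else 0) W, ?_, ?_, ?_, ?_⟩
  · intro z hz
    simpa using spectrum.subset_circle_of_unitary hW (hfin.mem_toFinset.mp hz)
  · intro z
    have h : cfc (fun x => if x = z then (1 : ℂ) else 0) W =
        (cfc (fun x => if x = z then (1 : ℂ) else 0) W)ᴴ *
          cfc (fun x => if x = z then (1 : ℂ) else 0) W := by
      rw [← Matrix.star_eq_conjTranspose, ← cfc_star, ← cfc_mul _ _ W (hc _) (hc _)]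
      congr 1
      ext x
      split_ifs <;> simp
    change Matrix.PosSemidef (cfc _ W)
    rw [h]
    exact Matrix.posSemidef_conjTranspose_mul_self _
  · rw [← cfc_sum _ _ _ fun z _ => hc _]
    conv_rhs => rw [← cfc_one ℂ W]
    refine cfc_congr fun x hx => ?_
    simp [Finset.sum_apply, hfin.mem_toFinset.mpr hx]
  · simp_rw [← cfc_smul (R := ℂ) _ _ W (hc _)]
    rw [← cfc_sum _ _ _ fun z _ => hc _]
    conv_rhs => rw [← cfc_id ℂ W]
    refine cfc_congr fun x hx => ?_
    simp [Finset.sum_apply, hfin.mem_toFinset.mpr hx]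

/-- The off-diagonal block of the reflection `2 P - 1` is the first moment of a finite
matrix-valued probability measure on the unit circle. -/
theorem exists_unimodular_decomposition_offDiag {B : Type} [Fintype B] [DecidableEq B]
    (P : Matrix (Fin 2 × B) (Fin 2 × B) ℂ) (hP : P.IsHermitian) (hPP : P * P = P) :
    ∃ (S : Finset ℂ) (Q : ℂ → Matrix B B ℂ), (∀ z ∈ S, ‖z‖ = 1) ∧ (∀ z, (Q z).PosSemidef) ∧
      ∑ z ∈ S, Q z = 1 ∧
        ∀ b b', ∑ z ∈ S, z * Q z b b' = 2 * P (0, b) (1, b') := by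
  let e : Fin 2 × B ≃ Fin 2 × B := (Equiv.swap 0 1).prodCongr (Equiv.refl B)
  let H : Matrix (Fin 2 × B) (Fin 2 × B) ℂ := (2 : ℂ) • P - 1
  have hHH : H * H = 1 := by
    simp only [H, sub_mul, mul_sub, Matrix.smul_mul, Matrix.mul_smul, hPP, mul_one, one_mul]
    module
  have hH : Hᴴ = H := by
    simp only [H, Matrix.conjTranspose_sub, Matrix.conjTranspose_smul, hP.eq,
      Matrix.conjTranspose_one]
    simp
  have hW : H.submatrix id e ∈ Matrix.unitaryGroup (Fin 2 × B) ℂ := by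
    rw [Matrix.mem_unitaryGroup_iff, Matrix.star_eq_conjTranspose, Matrix.conjTranspose_submatrix,
      hH, Matrix.submatrix_mul_equiv, hHH, Matrix.submatrix_id_id]
  obtain ⟨S, Q, hS, hQ, h1, hz⟩ := exists_spectral_decomposition_of_unitary _ hW
  refine ⟨S, fun z => (Q z).submatrix (Prod.mk 0) (Prod.mk 0), hS, fun z => (hQ z).submatrix _,
    ?_, fun b b' => ?_⟩
  · ext b b'
    have h := congrFun (congrFun h1 (0, b)) (0, b')
    simp only [Matrix.sum_apply, Matrix.one_apply, Prod.mk.injEq, true_and] at h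
    simpa only [Matrix.sum_apply, Matrix.one_apply, Matrix.submatrix_apply] using h
  · have h := congrFun (congrFun hz (0, b)) (0, b')
    simp only [Matrix.sum_apply, Matrix.smul_apply, smul_eq_mul] at h
    simp only [Matrix.submatrix_apply, h]
    simp [H, e]

/-- The states `s • 1 + t • (1 + 2 P)` with `P` an orthogonal projection and `s, t ≥ 0` are
separable on `ℂ² ⊗ ℂ^B`. -/
theorem isSeparableState_smul_one_add_smul_proj {B : Type} [Fintype B] [DecidableEq B] [Nonempty B]
    (P : Matrix (Fin 2 × B) (Fin 2 × B) ℂ) (hP : P.IsHermitian) (hPP : P * P = P) {s t : ℝ}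
    (hs : 0 ≤ s) (ht : 0 ≤ t)
    (htr : ((s : ℂ) • (1 : Matrix (Fin 2 × B) (Fin 2 × B) ℂ) +
      (t : ℂ) • (1 + (2 : ℂ) • P)).trace = 1) :
    IsSeparableState ((s : ℂ) • (1 : Matrix (Fin 2 × B) (Fin 2 × B) ℂ) +
      (t : ℂ) • (1 + (2 : ℂ) • P)) := by
  obtain ⟨S, Q, hS, hQ, h1, hz⟩ := exists_unimodular_decomposition_offDiag P hP hPP
  have hPpos : P.PosSemidef := by
    have h := Matrix.posSemidef_conjTranspose_mul_self P
    rwa [hP.eq, hPP] at h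
  have hs' : (0 : ℂ) ≤ s := by exact_mod_cast hs
  have ht' : (0 : ℂ) ≤ t := by exact_mod_cast ht
  let X : Option (Fin 2) ⊕ S → Matrix (Fin 2) (Fin 2) ℂ :=
    Sum.elim (fun o => o.elim 1 fun i => Matrix.diagonal (Pi.single i 1))
      fun z => Matrix.vecMulVec ![1, star (z : ℂ)] (star ![1, star (z : ℂ)])
  let Y : Option (Fin 2) ⊕ S → Matrix B B ℂ :=
    Sum.elim (fun o => o.elim ((s : ℂ) • 1)
      fun i => (t : ℂ) • (2 : ℂ) • P.submatrix (Prod.mk i) (Prod.mk i))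
      fun z => (t : ℂ) • Q z
  have hz' : ∀ b b', ∑ z ∈ S, star z * Q z b b' = 2 * P (1, b) (0, b') := by
    intro b b'
    have h := congrArg star (hz b' b)
    simp only [star_sum, star_mul', (hQ _).isHermitian.apply, hP.apply] at h
    simpa using h
  have h1' : ∀ b b', ∑ z ∈ S, Q z b b' = (1 : Matrix B B ℂ) b b' := fun b b' => by
    rw [← h1, Matrix.sum_apply]
  have hunit : ∀ z ∈ S, star z * z = 1 := fun z h => by
    rw [Complex.star_def, Complex.conj_mul', hS z h]; simp
  have hdec : (s : ℂ) • (1 : Matrix (Fin 2 × B) (Fin 2 × B) ℂ) +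
      (t : ℂ) • (1 + (2 : ℂ) • P) = ∑ i, X i ⊗ₖ Y i := by
    ext ⟨i, b⟩ ⟨i', b'⟩
    have key : ∑ z : S, (Matrix.vecMulVec ![1, star (z : ℂ)] (star ![1, star (z : ℂ)]) i i') *
        (t * Q z b b') = t * ∑ z ∈ S,
          (Matrix.vecMulVec ![1, star z] (star ![1, star z]) i i') * Q z b b' := by
      rw [Finset.sum_coe_sort S fun z => (Matrix.vecMulVec ![1, star (z : ℂ)]
        (star ![1, star (z : ℂ)]) i i') * (t * Q z b b'), Finset.mul_sum]
      exact Finset.sum_congr rfl fun z _ => by ring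
    simp only [X, Y, Fintype.sum_sum_type, Fintype.sum_option, Matrix.add_apply, Matrix.sum_apply,
      Matrix.kroneckerMap_apply, Sum.elim_inl, Sum.elim_inr, Option.elim, Matrix.smul_apply,
      smul_eq_mul, key, Fin.sum_univ_two, Matrix.submatrix_apply]
    fin_cases i <;> fin_cases i'
    · simp [Matrix.vecMulVec_apply, h1', Matrix.one_apply]
      split_ifs <;> ring
    · simp [Matrix.vecMulVec_apply, hz]
    · have h := hz' b b'
      simp only [Complex.star_def] at h
      simp [Matrix.vecMulVec_apply, h]
    · have h : ∑ z ∈ S, star z * z * Q z b b' = (1 : Matrix B B ℂ) b b' := by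
        rw [← h1']
        exact Finset.sum_congr rfl fun z h => by rw [hunit z h, one_mul]
      simp only [Complex.star_def] at h
      simp [Matrix.vecMulVec_apply, h, Matrix.one_apply]
      split_ifs <;> ring
  rw [hdec] at htr ⊢
  refine isSeparableState_of_sum_kronecker X Y ?_ ?_ htr
  · rintro ((_ | i) | z)
    · exact Matrix.PosSemidef.one
    · refine Matrix.PosSemidef.diagonal fun k => ?_
      by_cases h : k = i
      · subst h; simp
      · simp [h]
    · exact Matrix.posSemidef_vecMulVec_self_star _
  · rintro ((_ | i) | z)
    · exact Matrix.PosSemidef.one.smul hs'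
    · exact ((hPpos.submatrix _).smul (by norm_num)).smul ht'
    · exact (hQ z).smul ht'

/-- The partial transpose witness: matrix elements of a separable state obey the positivity of the
partial transpose in the direction `|0 x⟩ - |1 y⟩`. -/
theorem IsSeparableState.partialTranspose_nonneg {B : Type} [Fintype B] [DecidableEq B]
    {ρ : Matrix (Fin 2 × B) (Fin 2 × B) ℂ} (h : IsSeparableState ρ) (x y : B) :
    0 ≤ ρ (0, x) (0, x) + ρ (1, y) (1, y) - ρ (1, x) (0, y) - ρ (0, y) (1, x) := by
  obtain ⟨m, p, ρA, ρB, hp, -, hA, hB, rfl⟩ := h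
  have hterm : ∀ l, 0 ≤ (p l : ℂ) * (ρA l 0 0 * ρB l x x + ρA l 1 1 * ρB l y y -
      ρA l 1 0 * ρB l x y - ρA l 0 1 * ρB l y x) := by
    intro l
    refine mul_nonneg (by exact_mod_cast hp l) ?_
    have h := ((hA l).1.transpose.kronecker (hB l).1).dotProduct_mulVec_nonneg
      (Pi.single (0, x) 1 - Pi.single (1, y) 1)
    simp only [star_sub, Pi.star_single, Matrix.mulVec_sub, sub_dotProduct, dotProduct_sub,
      Matrix.mulVec_single_one, star_one, single_dotProduct, one_mul, Matrix.col_apply,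
      Matrix.kroneckerMap_apply, Matrix.transpose_apply] at h
    convert h using 1
    ring
  have hsum := Finset.sum_nonneg fun l (_ : l ∈ Finset.univ) => hterm l
  convert hsum using 1
  simp only [Matrix.sum_apply, Matrix.smul_apply, Matrix.kroneckerMap_apply, smul_eq_mul,
    ← Finset.sum_add_distrib, ← Finset.sum_sub_distrib]
  exact Finset.sum_congr rfl fun l _ => by ring

/-- Conjugating a diagonal projection of large enough corank by a suitable unitary gives a
projection that vanishes at two diagonal places and equals `1 / 2` at a given off-diagonal place. -/
theorem exists_unitary_conj_diagonal {N : Type} [Fintype N] [DecidableEq N] (p : N → Prop)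
    [DecidablePred p] (S : Finset N) (hcard : Fintype.card {x // p x} = S.card) {a c f g : N}
    (ha : a ∈ S) (hc : c ∉ S) (hf : f ∉ S) (hg : g ∉ S) (hfc : f ≠ c) (hgc : g ≠ c) :
    ∃ U : Matrix.unitaryGroup N ℂ, ∃ P : Matrix N N ℂ,
      (U : Matrix N N ℂ) * Matrix.diagonal (fun x => if p x then (1 : ℂ) else 0) *
        (U : Matrix N N ℂ)ᴴ = P ∧ P f f = 0 ∧ P g g = 0 ∧ P a c = 1 / 2 ∧ P c a = 1 / 2 := by
  have hac : a ≠ c := fun h => hc (h ▸ ha)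
  obtain ⟨h, hh⟩ : ∃ h : ℂ, h * star h = 1 / 2 := by
    refine ⟨(1 + Complex.I) / 2, ?_⟩
    simp only [Complex.star_def, map_div₀, map_add, map_one, Complex.conj_I, map_ofNat]
    linear_combination (-1 / 4 : ℂ) * Complex.I_mul_I
  let V : Matrix N N ℂ := 1 + ((h - 1) • Matrix.single a a 1 + h • Matrix.single a c 1 +
    h • Matrix.single c a 1 + (-h - 1) • Matrix.single c c 1)
  have hV : V * Vᴴ = 1 := by
    simp only [V, Matrix.conjTranspose_add, Matrix.conjTranspose_smul, Matrix.conjTranspose_one,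
      Matrix.conjTranspose_single, add_mul, mul_add, one_mul, mul_one, Matrix.smul_mul,
      Matrix.mul_smul, Matrix.single_mul_single_same, Matrix.single_mul_single_of_ne _ _ _ _ hac,
      Matrix.single_mul_single_of_ne _ _ _ _ hac.symm, star_one, star_sub, star_neg, smul_zero,
      add_zero, zero_add]
    match_scalars <;> first | ring1 | linear_combination 2 * hh
  let σ : Equiv.Perm N :=
    (Fintype.equivOfCardEq (hcard.trans (Fintype.card_coe S).symm) :
      {x // p x} ≃ {x // x ∈ S}).extendSubtype
  have hσ : ∀ k, p (σ.symm k) ↔ k ∈ S := by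
    intro k
    constructor
    · intro hk
      simpa [σ] using Equiv.extendSubtype_mem
        (Fintype.equivOfCardEq (hcard.trans (Fintype.card_coe S).symm) :
          {x // p x} ≃ {x // x ∈ S}) _ hk
    · intro hk
      by_contra hn
      exact Equiv.extendSubtype_not_mem
        (Fintype.equivOfCardEq (hcard.trans (Fintype.card_coe S).symm) :
          {x // p x} ≃ {x // x ∈ S}) _ hn (by simpa [σ] using hk)
  let T : Matrix N N ℂ := (1 : Matrix N N ℂ).submatrix σ.symm id
  have hT : T * Tᴴ = 1 := by
    ext x y
    simp [T, Matrix.mul_apply, Matrix.one_apply, eq_comm]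
  have hTD : T * Matrix.diagonal (fun x => if p x then (1 : ℂ) else 0) * Tᴴ =
      Matrix.diagonal fun x => if x ∈ S then (1 : ℂ) else 0 := by
    ext x y
    rw [Matrix.mul_apply]
    simp only [Matrix.mul_diagonal, T, Matrix.submatrix_apply, Matrix.conjTranspose_apply, id,
      Matrix.one_apply, Matrix.diagonal_apply, ← hσ x]
    rw [Finset.sum_eq_single (σ.symm x)]
    · simp [eq_comm]
    · intro b _ hb
      simp [hb.symm]
    · simp
  have hU : V * T ∈ Matrix.unitaryGroup N ℂ :=
    mul_mem (Matrix.mem_unitaryGroup_iff.mpr hV) (Matrix.mem_unitaryGroup_iff.mpr hT)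
  have hentry : ∀ x y, (V * T * Matrix.diagonal (fun x => if p x then (1 : ℂ) else 0) *
      (V * T)ᴴ) x y = ∑ k ∈ S, V x k * star (V y k) := by
    intro x y
    rw [Matrix.conjTranspose_mul, mul_assoc V T, mul_assoc V, ← mul_assoc _ Tᴴ, hTD, ← mul_assoc,
      Matrix.mul_apply]
    simp [Matrix.mul_diagonal, Finset.sum_ite_mem]
  have hrow : ∀ x, x ∉ S → x ≠ c → ∀ k ∈ S, V x k = 0 := by
    intro x hx hxc k hk
    have h1 : a ≠ x := fun h => hx (h ▸ ha)
    have h2 : x ≠ k := fun h => hx (h ▸ hk)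
    simp [V, h1, hxc.symm, h2]
  have hcol : ∀ k ∈ S, k ≠ a → V c k = 0 := by
    intro k hk hka
    have h1 : c ≠ k := fun h => hc (h ▸ hk)
    simp [V, hka.symm, h1]
  have hVaa : V a a = h := by simp [V, hac.symm]
  have hVca : V c a = h := by simp [V, hac, hac.symm]
  refine ⟨⟨V * T, hU⟩, _, rfl, ?_, ?_, ?_, ?_⟩
  · rw [hentry]
    exact Finset.sum_eq_zero fun k hk => by rw [hrow f hf hfc k hk, zero_mul]
  · rw [hentry]
    exact Finset.sum_eq_zero fun k hk => by rw [hrow g hg hgc k hk, zero_mul]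
  · rw [hentry, Finset.sum_eq_single_of_mem a ha fun k hk hka => by
      rw [hcol k hk hka, star_zero, mul_zero], hVaa, hVca, hh]
  · rw [hentry, Finset.sum_eq_single_of_mem a ha fun k hk hka => by
      rw [hcol k hk hka, zero_mul], hVaa, hVca, hh]

theorem trace_reindex {M N : Type} [Fintype M] [Fintype N] (e : M ≃ N) (A : Matrix M M ℂ) :
    (Matrix.reindex e e A).trace = A.trace :=
  e.symm.sum_comp fun i => A i i

/-- The projection onto the subspace where the first qubit is `|0⟩`. -/
noncomputable def firstQubitZero (n : ℕ) : Matrix (Bits (n + 1)) (Bits (n + 1)) ℂ :=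
  Matrix.diagonal fun x => if x 0 = 0 then (1 : ℂ) else 0

theorem reindex_single_kronecker_one (n : ℕ) :
    Matrix.reindex (qubitSplit (0 : Fin (n + 1))).symm (qubitSplit (0 : Fin (n + 1))).symm
      ((Matrix.single 0 0 1 : Matrix (Fin 2) (Fin 2) ℂ) ⊗ₖ (1 : Matrix (Bits n) (Bits n) ℂ)) =
    firstQubitZero n := by
  have hfst : ∀ x : Bits (n + 1), (qubitSplit 0 x).1 = x 0 := fun _ => rfl
  ext x y
  simp only [Matrix.reindex_apply, Equiv.symm_symm, Matrix.submatrix_apply,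
    Matrix.kroneckerMap_apply, Matrix.single_apply, firstQubitZero, Matrix.diagonal_apply,
    Matrix.one_apply, hfst]
  have hxy : x = y ↔ x 0 = y 0 ∧ (qubitSplit 0 x).2 = (qubitSplit 0 y).2 := by
    rw [← hfst x, ← hfst y, ← Prod.ext_iff, (qubitSplit 0).injective.eq_iff]
  by_cases h0 : x 0 = 0 <;> by_cases h1 : y 0 = 0 <;>
    simp [hxy, h0, h1, eq_comm]

theorem trace_firstQubitZero (n : ℕ) : (firstQubitZero n).trace = 2 ^ n := by
  rw [← reindex_single_kronecker_one, trace_reindex,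
    Matrix.trace_kronecker]
  simp

theorem card_firstQubitZero (n : ℕ) : Fintype.card {x : Bits (n + 1) // x 0 = 0} = 2 ^ n := by
  have h := trace_firstQubitZero n
  rw [firstQubitZero, Matrix.trace_diagonal, Finset.sum_boole, ← Fintype.card_subtype] at h
  exact_mod_cast h

theorem dqc1Output_eq (n : ℕ) (α : ℝ) (U : Matrix.unitaryGroup (Bits (n + 1)) ℂ) :
    dqc1Output n α U = (((1 - α) / 2 ^ n : ℝ) : ℂ) •
      ((U : Matrix (Bits (n + 1)) (Bits (n + 1)) ℂ) * firstQubitZero n *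
        (U : Matrix (Bits (n + 1)) (Bits (n + 1)) ℂ)ᴴ) + ((α / 2 ^ (n + 1) : ℝ) : ℂ) • 1 := by
  have hU : (U : Matrix (Bits (n + 1)) (Bits (n + 1)) ℂ) *
      (U : Matrix (Bits (n + 1)) (Bits (n + 1)) ℂ)ᴴ = 1 := Matrix.mem_unitaryGroup_iff.mp U.2
  rw [dqc1Output, dqc1State, reindex_single_kronecker_one, mul_add, add_mul, Matrix.mul_smul,
    Matrix.smul_mul, Matrix.mul_smul, Matrix.smul_mul, mul_one, hU]

theorem not_entangledAcross_dqc1Output {n : ℕ} {α : ℝ} (hα : 1 / 2 ≤ α) (hα1 : α ≤ 1)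
    (j : Fin (n + 1)) (U : Matrix.unitaryGroup (Bits (n + 1)) ℂ) :
    ¬ EntangledAcross j (dqc1Output n α U) := by
  have hU : (U : Matrix (Bits (n + 1)) (Bits (n + 1)) ℂ)ᴴ *
      (U : Matrix (Bits (n + 1)) (Bits (n + 1)) ℂ) = 1 := Matrix.mem_unitaryGroup_iff'.mp U.2
  set M := (U : Matrix (Bits (n + 1)) (Bits (n + 1)) ℂ) * firstQubitZero n *
        (U : Matrix (Bits (n + 1)) (Bits (n + 1)) ℂ)ᴴ with hM
  have hR : firstQubitZero n * firstQubitZero n = firstQubitZero n := by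
    simp [firstQubitZero, Matrix.diagonal_mul_diagonal]
  have hRh : (firstQubitZero n).IsHermitian := by
    refine Matrix.isHermitian_diagonal_of_self_adjoint _ ?_
    ext x
    by_cases h : x 0 = 0 <;> simp [h]
  have hMM : M * M = M := by
    simp only [hM, mul_assoc]
    rw [← mul_assoc _ (U : Matrix (Bits (n + 1)) (Bits (n + 1)) ℂ), hU, one_mul,
      ← mul_assoc (firstQubitZero n), hR]
  have hMh : M.IsHermitian := Matrix.isHermitian_mul_mul_conjTranspose _ hRh
  have hMtr : M.trace = 2 ^ n := by
    rw [hM, Matrix.trace_mul_comm, ← mul_assoc, hU, one_mul, trace_firstQubitZero]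
  let P := Matrix.reindex (qubitSplit j) (qubitSplit j) M
  have heq : Matrix.reindex (qubitSplit j) (qubitSplit j) (dqc1Output n α U) =
      (((2 * α - 1) / 2 ^ (n + 1) : ℝ) : ℂ) • (1 : Matrix (Fin 2 × Bits n) (Fin 2 × Bits n) ℂ) +
        (((1 - α) / 2 ^ (n + 1) : ℝ) : ℂ) • (1 + (2 : ℂ) • P) := by
    rw [dqc1Output_eq, ← hM]
    have h1 : (1 : Matrix (Fin 2 × Bits n) (Fin 2 × Bits n) ℂ) =
        Matrix.reindex (qubitSplit j) (qubitSplit j) 1 := by simp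
    rw [h1]
    ext x y
    simp only [P, Matrix.reindex_apply, Matrix.submatrix_apply, Matrix.add_apply,
      Matrix.smul_apply, smul_eq_mul]
    push_cast
    field_simp
    ring
  rw [EntangledAcross, not_not, heq]
  refine isSeparableState_smul_one_add_smul_proj P (hMh.submatrix _) ?_ ?_ ?_ ?_
  · simp only [P, Matrix.reindex_apply, Matrix.submatrix_mul_equiv, hMM]
  · exact div_nonneg (by linarith) (by positivity)
  · exact div_nonneg (by linarith) (by positivity)
  · rw [← heq, trace_reindex, dqc1Output_eq, ← hM,
      Matrix.trace_add, Matrix.trace_smul, Matrix.trace_smul, hMtr, Matrix.trace_one]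
    simp only [Fintype.card_fun, Fintype.card_fin, smul_eq_mul]
    push_cast
    field_simp
    ring

theorem exists_entangledAcross_dqc1Output {n : ℕ} (hn : 2 ≤ n) {α : ℝ} (hα : α < 1 / 2)
    (j : Fin (n + 1)) :
    ∃ U : Matrix.unitaryGroup (Bits (n + 1)) ℂ, EntangledAcross j (dqc1Output n α U) := by
  let x : Bits n := fun _ => 0
  let y : Bits n := fun _ => 1
  have hxy : x ≠ y := fun h => absurd (congrFun h ⟨0, by omega⟩) (by simp [x, y])
  let e := (qubitSplit j).symm
  have hpow : 4 ≤ 2 ^ n := by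
    simpa using Nat.pow_le_pow_right (show 0 < 2 by norm_num) hn
  have hne : ∀ u v, u ≠ v → e u ≠ e v := fun u v h => e.injective.ne h
  obtain ⟨S, hS1, hS2, hScard⟩ := Finset.exists_subsuperset_card_eq
    (s := {e (1, x)}) (t := ({e (0, y), e (0, x), e (1, y)} : Finset (Bits (n + 1)))ᶜ)
    (n := 2 ^ n) (by simp [e, hxy]) (by simp; omega) (by
      rw [Finset.card_compl]
      have := Finset.card_le_three (a := e (0, y)) (b := e (0, x)) (c := e (1, y))
      simp only [Fintype.card_fun, Fintype.card_fin]
      omega)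
  have hnot : ∀ u ∈ ({e (0, y), e (0, x), e (1, y)} : Finset (Bits (n + 1))), u ∉ S :=
    fun u hu hS => Finset.mem_compl.mp (hS2 hS) hu
  obtain ⟨U, P, hP, hff, hgg, hac, hca⟩ := exists_unitary_conj_diagonal
    (fun z : Bits (n + 1) => z 0 = 0) S ((card_firstQubitZero n).trans hScard.symm)
    (a := e (1, x)) (c := e (0, y)) (f := e (0, x)) (g := e (1, y)) (hS1 (by simp))
    (hnot _ (by simp)) (hnot _ (by simp)) (hnot _ (by simp)) (hne _ _ (by simp [hxy]))
    (hne _ _ (by simp))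
  refine ⟨U, fun hsep => ?_⟩
  have hw := hsep.partialTranspose_nonneg x y
  rw [dqc1Output_eq, firstQubitZero, hP] at hw
  simp only [Matrix.reindex_apply, Matrix.submatrix_apply, Matrix.add_apply, Matrix.smul_apply,
    smul_eq_mul] at hw
  change 0 ≤ _ * P (e (0, x)) (e (0, x)) + _ * (1 : Matrix _ _ ℂ) (e (0, x)) (e (0, x)) +
    (_ * P (e (1, y)) (e (1, y)) + _ * (1 : Matrix _ _ ℂ) (e (1, y)) (e (1, y))) -
    (_ * P (e (1, x)) (e (0, y)) + _ * (1 : Matrix _ _ ℂ) (e (1, x)) (e (0, y))) -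
    (_ * P (e (0, y)) (e (1, x)) + _ * (1 : Matrix _ _ ℂ) (e (0, y)) (e (1, x))) at hw
  rw [hff, hgg, hac, hca, Matrix.one_apply_eq, Matrix.one_apply_eq,
    Matrix.one_apply_ne (hne _ _ (by simp)), Matrix.one_apply_ne (hne _ _ (by simp))] at hw
  have hval : (0 : ℂ) ≤ (((2 * α - 1) / 2 ^ n : ℝ) : ℂ) := by
    convert hw using 1
    push_cast
    field_simp
    ring
  have hval' : 0 ≤ (2 * α - 1) / 2 ^ n := by exact_mod_cast hval
  have hneg : (2 * α - 1) / 2 ^ n < 0 := div_neg_of_neg_of_pos (by linarith) (by positivity)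
  linarith

/-- A DQC1 circuit on `n + 1` qubits cannot generate entanglement at any `{1;n}` bipartition if and
only if `1 / 2 ≤ α`; and the same equivalence holds at each single `{1;n}` bipartition. -/
theorem mainTheorem3 (n : ℕ) (hn : 2 ≤ n) (α : ℝ) (hα0 : 0 ≤ α) (hα1 : α ≤ 1) :
    ((¬ ∃ (j : Fin (n + 1)) (U : Matrix.unitaryGroup (Bits (n + 1)) ℂ),
        EntangledAcross j (dqc1Output n α U)) ↔ 1 / 2 ≤ α) ∧
    ∀ j : Fin (n + 1),
      ((¬ ∃ U : Matrix.unitaryGroup (Bits (n + 1)) ℂ,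
        EntangledAcross j (dqc1Output n α U)) ↔ 1 / 2 ≤ α) := by
  refine ⟨⟨fun h => ?_, ?_⟩, fun j => ⟨fun h => ?_, ?_⟩⟩
  · by_contra hα
    exact h ⟨0, exists_entangledAcross_dqc1Output hn (not_le.mp hα) 0⟩
  · rintro hα ⟨j, U, hU⟩
    exact not_entangledAcross_dqc1Output hα hα1 j U hU
  · by_contra hα
    exact h (exists_entangledAcross_dqc1Output hn (not_le.mp hα) j)
  · rintro hα ⟨U, hU⟩
    exact not_entangledAcross_dqc1Output hα hα1 j U hU
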